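/- Let $n,m\ge 0$, let $a:\mathbb R^n\to\mathbb R^{n\times n}$ and $b:\mathbb R^n\to\mathbb R^{n\times m}$ be continuous, let $Q\in\mathbb R^{n\times n}$ and $R\in\mathbb R^{m\times m}$ be symmetric positive definite, let $U\subseteq\mathbb R^m$ be any set of control values, $T>0$, and $\psi:\mathbb R^n\to\mathbb R$ any function. Put $L(x,u)=x^{\top}Qx+u^{\top}Ru$. An admissible control is a measurable function $u:\mathbb R\to\mathbb R^m$ with $u(t)\in U$ for almost every $t$. For $(s,y)\in[0,T]\times\mathbb R^n$ let $$V^*(s,y)=\inf\Big\{\int_s^T L(x(t),u(t))\,dt+\psi(x(T))\Big\}\in[-\infty,+\infty],$$ where the infimum is over all admissible controls $u$ and all absolutely continuous solutions $x:[s,T]\to\mathbb R^n$ of $$\dot x(t)=a(x(t))x(t)+b(x(t))u(t)\ \text{ for a.e. } t\in[s,T],\qquad x(s)=y$$ (the infimum of the empty set being $+\infty$). Theorem. Let $(t,x)\in[0,T]\times\mathbb R^n$ be a point at which $V^*$, as a function on $[0,T]\times\mathbb R^n$, is differentiable, that is, $V^*$ is finite on a relative neighbourhood of $(t,x)$ in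 $[0,T]\times\mathbb R^n$ and has a Fréchet derivative $(V^*_t,V^*_x)$ there (one-sided in time if $t=0$ or $t=T$). Then at this point $V^*$ satisfies the Hamilton–Jacobi–Bellman equation $$V^*_t(t,x)+\inf_{u\in U}\big\{L(x,u)+V^*_x(t,x)\,\big(a(x)x+b(x)u\big)\big\}=0 .$$ -/

import Mathlib

open MeasureTheory Set Filter Topology
open scoped Matrix ENNReal

/-- The right-hand side `a(x) x + b(x) u` of the control-affine system. -/
def affineField {n m : ℕ} (a : (Fin n → ℝ) → Matrix (Fin n) (Fin n) ℝ)
    (b : (Fin n → ℝ) → Matrix (Fin n) (Fin m) ℝ) (x : Fin n → ℝ) (u : Fin m → ℝ) : Fin n → ℝ :=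
  a x *ᵥ x + b x *ᵥ u

/-- The quadratic running cost `L(x,u) = xᵀ Q x + uᵀ R u`. -/
def runningCost {n m : ℕ} (Q : Matrix (Fin n) (Fin n) ℝ) (R : Matrix (Fin m) (Fin m) ℝ)
    (x : Fin n → ℝ) (u : Fin m → ℝ) : ℝ :=
  x ⬝ᵥ (Q *ᵥ x) + u ⬝ᵥ (R *ᵥ u)

/-- Admissible controls: measurable functions with `u(t) ∈ U` for almost every `t`. -/
def IsAdmissibleControl {m : ℕ} (U : Set (Fin m → ℝ)) (u : ℝ → Fin m → ℝ) : Prop :=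
  Measurable u ∧ ∀ᵐ t : ℝ, u t ∈ U

/-- `x` is a (Carathéodory) solution on `[s, T]` of `ẋ = a(x) x + b(x) u(t)`, `x(s) = y`:
the velocity is integrable and `x` is its primitive starting from `y`; equivalently, `x` is
absolutely continuous on `[s, T]`, starts at `y` and solves the equation almost everywhere. -/
structure IsTrajectory {n m : ℕ} (a : (Fin n → ℝ) → Matrix (Fin n) (Fin n) ℝ)
    (b : (Fin n → ℝ) → Matrix (Fin n) (Fin m) ℝ) (s T : ℝ) (y : Fin n → ℝ)
    (u : ℝ → Fin m → ℝ) (x : ℝ → Fin n → ℝ) : Prop where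
  intervalIntegrable :
    IntervalIntegrable (fun τ => affineField a b (x τ) (u τ)) volume s T
  eq_integral : ∀ t ∈ Icc s T, x t = y + ∫ τ in s..t, affineField a b (x τ) (u τ)

/-- The cost `∫ₛᵀ L(x,u) dt + ψ(x(T))` of a control and a trajectory. The running cost is
nonnegative, so the integral always makes sense as an extended nonnegative number. -/
noncomputable def totalCost {n m : ℕ} (Q : Matrix (Fin n) (Fin n) ℝ)
    (R : Matrix (Fin m) (Fin m) ℝ) (ψ : (Fin n → ℝ) → ℝ) (s T : ℝ)
    (u : ℝ → Fin m → ℝ) (x : ℝ → Fin n → ℝ) : EReal :=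
  ((∫⁻ t in Ioc s T, ENNReal.ofReal (runningCost Q R (x t) (u t)) : ℝ≥0∞) : EReal)
    + ((ψ (x T) : ℝ) : EReal)

/-- The optimal cost `V*(s,y)`: the infimum, in the extended reals, of the cost over all
admissible controls and all corresponding trajectories on `[s, T]` starting at `x(s) = y`. -/
noncomputable def valueFunction {n m : ℕ} (a : (Fin n → ℝ) → Matrix (Fin n) (Fin n) ℝ)
    (b : (Fin n → ℝ) → Matrix (Fin n) (Fin m) ℝ) (Q : Matrix (Fin n) (Fin n) ℝ)
    (R : Matrix (Fin m) (Fin m) ℝ) (U : Set (Fin m → ℝ)) (ψ : (Fin n → ℝ) → ℝ) (T : ℝ)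
    (s : ℝ) (y : Fin n → ℝ) : EReal :=
  sInf {c | ∃ (u : ℝ → Fin m → ℝ) (x : ℝ → Fin n → ℝ), IsAdmissibleControl U u ∧
    IsTrajectory a b s T y u x ∧ c = totalCost Q R ψ s T u x}

/-- An extended-real function `V(t,x)` is differentiable, with differential `D`, at a point of
`[0, T] × ℝⁿ`, as a function on `[0, T] × ℝⁿ`: it is finite near the point, and there its real
values have the Fréchet derivative `D` (one-sided in time at `t = 0` and `t = T`). -/
def HasDifferentialOnStrip {n : ℕ} (T : ℝ) (V : ℝ → (Fin n → ℝ) → EReal)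
    (D : ℝ × (Fin n → ℝ) →L[ℝ] ℝ) (z : ℝ × (Fin n → ℝ)) : Prop :=
  (∀ᶠ w in 𝓝[Icc (0 : ℝ) T ×ˢ univ] z, V w.1 w.2 ≠ ⊤ ∧ V w.1 w.2 ≠ ⊥) ∧
    HasFDerivWithinAt (fun w : ℝ × (Fin n → ℝ) => (V w.1 w.2).toReal) D
      (Icc (0 : ℝ) T ×ˢ univ) z

/-- The infimum over control values `u ∈ U` of `L(x,u) + p (a(x) x + b(x) u)`, taken in the
extended reals, where the covector `p` stands for `V_x`. -/
noncomputable def hamiltonian {n m : ℕ} (a : (Fin n → ℝ) → Matrix (Fin n) (Fin n) ℝ)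
    (b : (Fin n → ℝ) → Matrix (Fin n) (Fin m) ℝ) (Q : Matrix (Fin n) (Fin n) ℝ)
    (R : Matrix (Fin m) (Fin m) ℝ) (U : Set (Fin m → ℝ)) (x : Fin n → ℝ)
    (p : (Fin n → ℝ) →L[ℝ] ℝ) : EReal :=
  ⨅ u ∈ U, ((runningCost Q R x u + p (affineField a b x u) : ℝ) : EReal)

/-! Both inequalities come from dynamic programming, and `V` is differentiated only at the given
point.

For `V_t + L + V_x f ≥ 0`, freeze a control value `u ∈ U` and follow a solution `X` of `ẋ = f(x,u)`
through `(t,x)`. Dynamic programming makes `V(s, X s) + ∫ L` nondecreasing between `t` and nearby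
times, so its derivative at `t` is nonnegative. The field is merely continuous, so `X` comes from
Peano's theorem. It is needed in both time directions, since at `t = T` only earlier times are
available.

Conversely, suppose the integrand is at least `δ > 0` for every `u ∈ U`. Take an `h ^ 2`-optimal
trajectory starting at `x` over an interval of length `h` containing `t`. Controls may be unbounded,
so its displacement must first be shown to be `O(h)`. Differentiability bounds the cost spent by `M
(2h + displacement) + h`, while coercivity of `L` bounds `M` times the displacement by half that
cost plus `K h`. Hence both are `O(h)` while the trajectory stays near `x`, and a barrier argument
keeps it there. Integrating the assumed lower bound and inserting the expansion of `V` gives `δ h ≤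
h ^ 2 + O(ε h)`, which is absurd for small `ε` and `h`. -/

/-! ### Peano's theorem by delayed approximations -/

/-- Shrinking of the real line towards `0` by `δ`. -/
noncomputable def shrink (δ τ : ℝ) : ℝ := τ - max (-δ) (min τ δ)

lemma continuous_shrink (δ : ℝ) : Continuous (shrink δ) := by
  unfold shrink; fun_prop

lemma abs_shrink_sub_le {δ : ℝ} (hδ : 0 ≤ δ) (τ : ℝ) : |shrink δ τ - τ| ≤ δ := by
  unfold shrink
  rw [abs_le]
  constructor <;> grind

lemma abs_shrink_le {δ c τ : ℝ} (hδ : 0 ≤ δ) (hc : 0 ≤ c) (h : |τ| ≤ c + δ) :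
    |shrink δ τ| ≤ c := by
  unfold shrink
  rw [abs_le] at *
  constructor <;> grind

section Peano

variable {E : Type*} [NormedAddCommGroup E] [NormedSpace ℝ E]

/-- Tonelli's delayed successive approximations of the solution of `ẋ = F(x)`, `x(0) = x₀`. -/
noncomputable def tonelli (F : E → E) (x₀ : E) (δ : ℝ) : ℕ → ℝ → E
  | 0 => fun _ => x₀
  | j + 1 => fun s => x₀ + ∫ τ in (0 : ℝ)..s, F (tonelli F x₀ δ j (shrink δ τ))

lemma continuous_tonelli {F : E → E} (hF : Continuous F) (x₀ : E) (δ : ℝ) (j : ℕ) :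
    Continuous (tonelli F x₀ δ j) := by
  induction j with
  | zero => exact continuous_const
  | succ j ih =>
    exact continuous_const.add (intervalIntegral.continuous_primitive (fun _ _ =>
      (hF.comp (ih.comp (continuous_shrink δ))).intervalIntegrable _ _) 0)

/-- Because of the delay, values at distance at most `(j + 1) δ` from `0` depend only on earlier
values within `j δ`. The iterates therefore stabilise one window of width `δ` at a time. -/
lemma tonelli_succ_eq {F : E → E} (x₀ : E) {δ : ℝ} (hδ : 0 ≤ δ) (j : ℕ) (s : ℝ)
    (hs : |s| ≤ j * δ) : tonelli F x₀ δ (j + 1) s = tonelli F x₀ δ j s := by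
  induction j generalizing s with
  | zero =>
    have : s = 0 := by simpa using hs
    simp [tonelli, this]
  | succ j ih =>
    have : ∀ τ ∈ uIcc 0 s, F (tonelli F x₀ δ (j + 1) (shrink δ τ))
        = F (tonelli F x₀ δ j (shrink δ τ)) := by
      intro τ hτ
      rw [ih]
      apply abs_shrink_le hδ (by positivity)
      have h1 : |τ| ≤ |s| := by
        simpa using abs_sub_left_of_mem_uIcc hτ
      push_cast at hs
      linarith
    exact congrArg (x₀ + ·) (intervalIntegral.integral_congr this)

lemma dist_tonelli_le {F : E → E} (hF : Continuous F) {K : ℝ} (hK0 : 0 ≤ K)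
    (hK : ∀ y, ‖F y‖ ≤ K) (x₀ : E)
    (δ : ℝ) (j : ℕ) (s s' : ℝ) :
    dist (tonelli F x₀ δ j s) (tonelli F x₀ δ j s') ≤ K * dist s s' := by
  cases j with
  | zero => simp [tonelli]; positivity
  | succ j =>
    have hc : Continuous fun τ => F (tonelli F x₀ δ j (shrink δ τ)) :=
      hF.comp ((continuous_tonelli hF x₀ δ j).comp (continuous_shrink δ))
    simp only [tonelli, dist_add_left]
    rw [dist_eq_norm, intervalIntegral.integral_interval_sub_left
      (hc.intervalIntegrable _ _) (hc.intervalIntegrable _ _), Real.dist_eq]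
    exact intervalIntegral.norm_integral_le_of_norm_le_const fun _ _ => hK _

/-- Solutions of an autonomous differential equation with bounded continuous right-hand side. -/
theorem exists_integral_solution_of_bounded [ProperSpace E] {F : E → E} (hF : Continuous F)
    {K : ℝ} (hK : ∀ y, ‖F y‖ ≤ K) (x₀ : E) {h : ℝ} (hh : 0 < h) :
    ∃ X : ℝ → E, Continuous X ∧ ∀ s, |s| ≤ h → X s = x₀ + ∫ τ in (0 : ℝ)..s, F (X τ) := by
  have hK0 : 0 ≤ K := (norm_nonneg _).trans (hK x₀)
  have hle : -h ≤ h := by linarith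
  -- With delay `h / (k + 1)`, exactly `k + 1` iterations make the iterate stable on all of `[-h,
  -- h]`, so it solves the delayed equation there.
  let δ : ℕ → ℝ := fun k => h / (k + 1)
  have hδ0 : ∀ k, 0 ≤ δ k := fun k => by positivity
  let Y : ℕ → ℝ → E := fun k => tonelli F x₀ (δ k) (k + 1)
  have hY : ∀ k, Continuous (Y k) := fun k => continuous_tonelli hF _ _ _
  have hY0 : ∀ k, Y k 0 = x₀ := fun k => by simp [Y, tonelli]
  have hYeq : ∀ k s, |s| ≤ h → Y k s = x₀ + ∫ τ in (0 : ℝ)..s, F (Y k (shrink (δ k) τ)) := by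
    intro k s hs
    refine (tonelli_succ_eq (F := F) x₀ (hδ0 k) (k + 1) s ?_).symm
    simp only [δ]
    push_cast
    rw [mul_div_cancel₀ _ (by positivity)]
    exact hs
  have hYL : ∀ k s s', dist (Y k s) (Y k s') ≤ K * dist s s' := fun k =>
    dist_tonelli_le hF hK0 hK x₀ _ _
  let f : ℕ → BoundedContinuousFunction (Icc (-h) h) E := fun k =>
    BoundedContinuousFunction.mkOfCompact ⟨fun s => Y k s, (hY k).comp continuous_subtype_val⟩
  -- Arzelà–Ascoli: the approximations share the Lipschitz constant `K` and the value `x₀` at `0`.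
  have hcomp : IsCompact (closure (range f)) := by
    refine BoundedContinuousFunction.arzela_ascoli (Metric.closedBall x₀ (K * h))
      (isCompact_closedBall _ _) _ ?_ ?_
    · rintro _ s ⟨k, rfl⟩
      rw [Metric.mem_closedBall, ← hY0 k]
      refine (hYL k s 0).trans (mul_le_mul_of_nonneg_left ?_ hK0)
      rw [Real.dist_eq, sub_zero]
      exact abs_le.2 s.2
    · refine Metric.equicontinuous_of_continuity_modulus (fun r => K * r) ?_ _ ?_
      · have : Continuous fun r : ℝ => K * r := by fun_prop
        simpa using this.tendsto 0
      · rintro s s' ⟨_, k, rfl⟩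
        exact hYL k s s'
  obtain ⟨g, -, φ, hφ, hg⟩ := hcomp.tendsto_subseq (x := f) fun k => subset_closure ⟨k, rfl⟩
  let X : ℝ → E := IccExtend hle g
  have hX : Continuous X := g.continuous.Icc_extend'
  have hlim : ∀ s, |s| ≤ h → Tendsto (fun k => Y (φ k) s) atTop (𝓝 (X s)) := by
    intro s hs
    have hs' : s ∈ Icc (-h) h := abs_le.1 hs
    have h1 := (continuous_eval_const (F := BoundedContinuousFunction (Icc (-h) h) E)
      (⟨s, hs'⟩ : Icc (-h) h)).continuousAt.tendsto.comp hg
    simp only [X, IccExtend_of_mem hle g hs']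
    exact h1
  have hδ : Tendsto (fun k => K * δ (φ k)) atTop (𝓝 0) := by
    have h1 : Tendsto δ atTop (𝓝 0) := by
      have := (tendsto_one_div_add_atTop_nhds_zero_nat (𝕜 := ℝ)).const_mul h
      simpa [δ, div_eq_mul_inv] using this
    simpa using (h1.comp hφ.tendsto_atTop).const_mul K
  have hlim' : ∀ s, |s| ≤ h →
      Tendsto (fun k => Y (φ k) (shrink (δ (φ k)) s)) atTop (𝓝 (X s)) := by
    intro s hs
    refine (hlim s hs).congr_dist ?_
    refine squeeze_zero (fun _ => dist_nonneg) (fun k => ?_) hδ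
    rw [dist_comm]
    refine (hYL _ _ _).trans (mul_le_mul_of_nonneg_left ?_ hK0)
    exact abs_shrink_sub_le (hδ0 _) s
  refine ⟨X, hX, fun s hs => ?_⟩
  refine tendsto_nhds_unique (hlim s hs) ?_
  simp_rw [hYeq _ s hs]
  refine tendsto_const_nhds.add ?_
  refine intervalIntegral.tendsto_integral_filter_of_dominated_convergence (fun _ => K)
    (Eventually.of_forall fun k => ?_) (Eventually.of_forall fun k => ae_of_all _ fun τ _ => hK _)
    intervalIntegrable_const (ae_of_all _ fun τ hτ => ?_)
  · exact (hF.comp ((hY _).comp (continuous_shrink _))).aestronglyMeasurable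
  · refine (hF.tendsto _).comp (hlim' τ ?_)
    have : |τ| ≤ |s| := by simpa using abs_sub_left_of_mem_uIcc (uIoc_subset_uIcc hτ)
    exact this.trans hs

/-- **Peano's theorem** for autonomous equations, in integral form, near the initial time `t`. -/
theorem exists_local_integral_solution [ProperSpace E] {F : E → E} (hF : Continuous F)
    (x₀ : E) (t : ℝ) : ∃ h > 0, ∃ X : ℝ → E, Continuous X ∧ X t = x₀ ∧
      ∀ s, |s - t| ≤ h → X s = x₀ + ∫ τ in t..s, F (X τ) := by
  -- A cutoff equal to `1` on the unit ball about `x₀` and `0` beyond radius `2` makes the field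
  -- bounded; for short times the solution does not leave the unit ball.
  let χ : E → ℝ := fun y => max 0 (min 1 (2 - ‖y - x₀‖))
  have hχ : Continuous χ := by fun_prop
  let G : E → E := fun y => χ y • F y
  have hG : Continuous G := hχ.smul hF
  obtain ⟨K, hK⟩ := (isCompact_closedBall x₀ 2).exists_bound_of_continuousOn hG.continuousOn
  have hK0 : 0 ≤ K := (norm_nonneg _).trans (hK x₀ (by simp))
  have hGK : ∀ y, ‖G y‖ ≤ K := by
    intro y
    by_cases hy : ‖y - x₀‖ ≤ 2
    · exact hK y (mem_closedBall_iff_norm.2 hy)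
    · have : χ y = 0 := by
        simp only [χ]; grind
      simp [G, this, hK0]
  have hGF : ∀ y, ‖y - x₀‖ ≤ 1 → G y = F y := by
    intro y hy
    have : χ y = 1 := by simp only [χ]; grind
    simp [G, this]
  obtain ⟨X, hX, hXeq⟩ := exists_integral_solution_of_bounded hG hGK x₀ one_pos
  have hX0 : X 0 = x₀ := by simpa using hXeq 0 (by simp)
  obtain ⟨h, hh, hball⟩ := Metric.continuous_iff.1 hX 0 1 one_pos
  refine ⟨min 1 (h / 2), by positivity, fun s => X (s - t), by fun_prop, by simp [hX0], ?_⟩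
  intro s hs
  beta_reduce
  rw [hXeq _ (hs.trans (min_le_left _ _)),
    intervalIntegral.integral_comp_sub_right (fun τ => F (X τ)), sub_self]
  congr 1
  refine intervalIntegral.integral_congr fun τ hτ => hGF _ ?_
  have h1 : |τ| ≤ |s - t| := by simpa using abs_sub_left_of_mem_uIcc hτ
  have h2 := hball τ (by
    rw [Real.dist_eq, sub_zero]
    have := hs.trans (min_le_right _ _)
    linarith)
  rw [hX0, dist_eq_norm] at h2
  exact h2.le

end Peano

/-! ### Coercivity of the running cost and continuity in the state -/

lemma norm_mulVec_le_sum_abs {k l : ℕ} (A : Matrix (Fin k) (Fin l) ℝ) (v : Fin l → ℝ) :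
    ‖A *ᵥ v‖ ≤ (∑ i, ∑ j, |A i j|) * ‖v‖ := by
  refine (pi_norm_le_iff_of_nonneg (by positivity)).2 fun i => ?_
  calc ‖(A *ᵥ v) i‖ ≤ ∑ j, ‖A i j * v j‖ := norm_sum_le Finset.univ (fun j => A i j * v j)
    _ ≤ ∑ j, |A i j| * ‖v‖ := by
        refine Finset.sum_le_sum fun j _ => ?_
        rw [norm_mul]
        exact mul_le_mul_of_nonneg_left (norm_le_pi_norm v j) (norm_nonneg _)
    _ = (∑ j, |A i j|) * ‖v‖ := (Finset.sum_mul _ _ _).symm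
    _ ≤ _ := by
        refine mul_le_mul_of_nonneg_right ?_ (norm_nonneg _)
        exact Finset.single_le_sum (f := fun i => ∑ j, |A i j|)
          (fun i _ => Finset.sum_nonneg fun j _ => abs_nonneg _) (Finset.mem_univ i)

/-- The constant is the minimum of the quadratic form on the compact unit sphere; homogeneity
extends the bound to all vectors. -/
lemma Matrix.PosDef.exists_mul_sq_norm_le {k : ℕ} {A : Matrix (Fin k) (Fin k) ℝ}
    (hA : A.PosDef) : ∃ c > 0, ∀ v : Fin k → ℝ, c * ‖v‖ ^ 2 ≤ v ⬝ᵥ (A *ᵥ v) := by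
  have hcont : Continuous fun v : Fin k → ℝ => v ⬝ᵥ (A *ᵥ v) := by fun_prop
  rcases isEmpty_or_nonempty (Fin k) with hk | hk
  · refine ⟨1, one_pos, fun v => ?_⟩
    have : v = 0 := Subsingleton.elim _ _
    simp [this]
  obtain ⟨w, hw, hmin⟩ := (isCompact_sphere (0 : Fin k → ℝ) 1).exists_isMinOn
    (NormedSpace.sphere_nonempty.2 zero_le_one) hcont.continuousOn
  have hw1 : ‖w‖ = 1 := by simpa using hw
  have hw0 : w ≠ 0 := by rintro rfl; simp at hw1
  refine ⟨w ⬝ᵥ (A *ᵥ w), by simpa using hA.dotProduct_mulVec_pos hw0, fun v => ?_⟩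
  by_cases hv : v = 0
  · simp [hv]
  have hv' : 0 < ‖v‖ := norm_pos_iff.2 hv
  have h1 : ‖v‖⁻¹ • v ∈ Metric.sphere (0 : Fin k → ℝ) 1 := by
    simp [norm_smul, hv'.ne']
  have h2 := isMinOn_iff.1 hmin _ h1
  simp only [Matrix.mulVec_smul, dotProduct_smul, smul_dotProduct, smul_eq_mul] at h2
  calc _ ≤ (‖v‖⁻¹ * (‖v‖⁻¹ * (v ⬝ᵥ (A *ᵥ v)))) * ‖v‖ ^ 2 := by gcongr
    _ = _ := by field_simp

section

variable {n m : ℕ} {a : (Fin n → ℝ) → Matrix (Fin n) (Fin n) ℝ}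
  {b : (Fin n → ℝ) → Matrix (Fin n) (Fin m) ℝ}
  {Q : Matrix (Fin n) (Fin n) ℝ} {R : Matrix (Fin m) (Fin m) ℝ}

lemma continuous_affineField (ha : Continuous a) (hb : Continuous b) (u : Fin m → ℝ) :
    Continuous fun x => affineField a b x u := by
  unfold affineField; fun_prop

lemma continuous_runningCost (Q : Matrix (Fin n) (Fin n) ℝ) (R : Matrix (Fin m) (Fin m) ℝ) :
    Continuous fun z : (Fin n → ℝ) × (Fin m → ℝ) => runningCost Q R z.1 z.2 := by
  unfold runningCost; fun_prop

lemma runningCost_nonneg (hQ : Q.PosDef) (hR : R.PosDef) (x : Fin n → ℝ) (u : Fin m → ℝ) :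
    0 ≤ runningCost Q R x u :=
  add_nonneg (by simpa using hQ.posSemidef.dotProduct_mulVec_nonneg x)
    (by simpa using hR.posSemidef.dotProduct_mulVec_nonneg u)

lemma exists_mul_sq_norm_le_runningCost (hQ : Q.PosDef) (hR : R.PosDef) :
    ∃ c > 0, ∀ (x : Fin n → ℝ) (u : Fin m → ℝ), c * ‖u‖ ^ 2 ≤ runningCost Q R x u := by
  obtain ⟨c, hc, h⟩ := hR.exists_mul_sq_norm_le
  refine ⟨c, hc, fun x u => (h u).trans ?_⟩
  have := hQ.posSemidef.dotProduct_mulVec_nonneg x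
  simp only [star_trivial] at this
  unfold runningCost
  linarith

/-- By coercivity of the running cost, the velocity is bounded by an arbitrarily small multiple
of it, up to a constant. -/
lemma exists_norm_affineField_le (ha : Continuous a) (hb : Continuous b) (hQ : Q.PosDef)
    (hR : R.PosDef) (x : Fin n → ℝ) {M : ℝ} (hM : 0 ≤ M) :
    ∃ K ≥ 0, ∀ y, ‖y - x‖ ≤ 1 → ∀ u,
      M * ‖affineField a b y u‖ ≤ runningCost Q R y u / 2 + K := by
  obtain ⟨c, hc, hcost⟩ := exists_mul_sq_norm_le_runningCost hQ hR
  have hcont : Continuous fun y => ∑ i, ∑ j, |b y i j| := by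
    refine continuous_finsetSum _ fun i _ => continuous_finsetSum _ fun j _ => ?_
    exact (hb.matrix_elem i j).abs
  obtain ⟨A, hA⟩ := (isCompact_closedBall x 1).exists_bound_of_continuousOn
    (f := fun y => a y *ᵥ y) (by fun_prop)
  obtain ⟨B, hB⟩ := (isCompact_closedBall x 1).exists_bound_of_continuousOn hcont.continuousOn
  have hA0 : 0 ≤ A := (norm_nonneg _).trans (hA x (by simp))
  -- The velocity is at most `A + B ‖u‖`; completing the square absorbs `M B ‖u‖` into `c ‖u‖ ^ 2 /
  -- 2`, at the price of the second term.
  refine ⟨M * A + (M * B) ^ 2 / (2 * c), by positivity, fun y hy u => ?_⟩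
  have hy' : y ∈ Metric.closedBall x 1 := mem_closedBall_iff_norm.2 hy
  have h1 : ‖affineField a b y u‖ ≤ A + B * ‖u‖ := by
    refine (norm_add_le _ _).trans (add_le_add (hA y hy') ?_)
    refine (norm_mulVec_le_sum_abs _ _).trans (mul_le_mul_of_nonneg_right ?_ (norm_nonneg _))
    exact (le_abs_self _).trans (hB y hy')
  have h2 : M * B * ‖u‖ ≤ c * ‖u‖ ^ 2 / 2 + (M * B) ^ 2 / (2 * c) := by
    rw [← sub_nonneg]
    have : c * ‖u‖ ^ 2 / 2 + (M * B) ^ 2 / (2 * c) - M * B * ‖u‖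
        = (c * ‖u‖ - M * B) ^ 2 / (2 * c) := by field_simp; ring
    rw [this]
    positivity
  nlinarith [hcost y u, mul_le_mul_of_nonneg_left h1 hM]

/-- Continuity in the state of the integrand of the Hamiltonian, relative to the running cost. -/
lemma exists_hamiltonian_integrand_le (ha : Continuous a) (hb : Continuous b) (hQ : Q.PosDef)
    (hR : R.PosDef) (x : Fin n → ℝ) (p : (Fin n → ℝ) →L[ℝ] ℝ) {ε : ℝ} (hε : 0 < ε) :
    ∃ ρ > 0, ∀ y, ‖y - x‖ ≤ ρ → ∀ u,
      runningCost Q R x u + p (affineField a b x u) ≤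
        runningCost Q R y u + p (affineField a b y u) + ε * (runningCost Q R y u + 1) := by
  obtain ⟨c, hc, hcost⟩ := exists_mul_sq_norm_le_runningCost hQ hR
  let g : (Fin n → ℝ) → ℝ := fun y => x ⬝ᵥ (Q *ᵥ x) + p (a x *ᵥ x) - y ⬝ᵥ (Q *ᵥ y) - p (a y *ᵥ y)
  let k : (Fin n → ℝ) → ℝ := fun y => ‖p‖ * ∑ i, ∑ j, |(b x - b y) i j|
  have hg : Continuous g := by fun_prop
  have hk : Continuous k := by
    refine continuous_const.mul ?_
    refine continuous_finsetSum _ fun i _ => continuous_finsetSum _ fun j _ => ?_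
    exact ((continuous_const.sub hb).matrix_elem i j).abs
  -- By `‖u‖ ≤ 1 + ‖u‖ ^ 2`, the error `k y * ‖u‖` splits into a constant, below `ε / 2`, and a
  -- quadratic part, below `ε c ‖u‖ ^ 2` and hence below `ε` times the cost.
  have hκ : 0 < min (ε / 2) (c * ε) := by positivity
  obtain ⟨ρ, hρ, hball⟩ := Metric.nhds_basis_closedBall.eventually_iff.1
    (((hg.tendsto x).eventually_lt_const (u := ε / 2) (by simpa [g] using hε)).and
      ((hk.tendsto x).eventually_lt_const (u := min (ε / 2) (c * ε)) (by simpa [k] using hκ)))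
  refine ⟨ρ, hρ, fun y hy u => ?_⟩
  obtain ⟨h1, h2⟩ := hball (mem_closedBall_iff_norm.2 hy)
  have h3 : p ((b x - b y) *ᵥ u) ≤ k y * ‖u‖ := by
    refine (le_abs_self _).trans ((p.le_opNorm _).trans ?_)
    simp only [k, mul_assoc]
    exact mul_le_mul_of_nonneg_left (norm_mulVec_le_sum_abs _ _) (norm_nonneg _)
  have h4 : runningCost Q R x u + p (affineField a b x u)
      - (runningCost Q R y u + p (affineField a b y u)) = g y + p ((b x - b y) *ᵥ u) := by
    simp only [runningCost, affineField, g, Matrix.sub_mulVec, map_add, map_sub]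
    ring
  have h5 : k y * ‖u‖ ≤ ε * (c * ‖u‖ ^ 2) + ε / 2 := by
    have hk0 : 0 ≤ k y := by positivity
    have h6 := lt_min_iff.1 h2
    have h7 : ‖u‖ ≤ 1 + ‖u‖ ^ 2 := by nlinarith [sq_nonneg (‖u‖ - 1), norm_nonneg u]
    nlinarith [mul_le_mul_of_nonneg_left h7 hk0, sq_nonneg ‖u‖]
  have h8 := mul_le_mul_of_nonneg_left (hcost y u) hε.le
  linarith

end

/-! ### Trajectories and dynamic programming -/

section

variable {n m : ℕ} {a : (Fin n → ℝ) → Matrix (Fin n) (Fin n) ℝ}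
  {b : (Fin n → ℝ) → Matrix (Fin n) (Fin m) ℝ}
  {Q : Matrix (Fin n) (Fin n) ℝ} {R : Matrix (Fin m) (Fin m) ℝ} {U : Set (Fin m → ℝ)}
  {ψ : (Fin n → ℝ) → ℝ} {s r T : ℝ} {y : Fin n → ℝ} {u : ℝ → Fin m → ℝ} {x : ℝ → Fin n → ℝ}

namespace IsTrajectory

lemma apply_left (hx : IsTrajectory a b s T y u x) (h : s ≤ T) : x s = y := by
  simpa using hx.eq_integral s (left_mem_Icc.2 h)

lemma continuousOn (hx : IsTrajectory a b s T y u x) (h : s ≤ T) :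
    ContinuousOn x (Icc s T) := by
  have h1 := intervalIntegral.continuousOn_primitive_interval'
    hx.intervalIntegrable left_mem_uIcc
  rw [uIcc_of_le h] at h1
  exact (continuousOn_const.add h1).congr hx.eq_integral

lemma head (hx : IsTrajectory a b s T y u x) (hs : s ≤ r) (hr : r ≤ T) :
    IsTrajectory a b s r y u x where
  intervalIntegrable := hx.intervalIntegrable.mono_set
    (by rw [uIcc_of_le hs, uIcc_of_le (hs.trans hr)]; exact Icc_subset_Icc_right hr)
  eq_integral t ht := hx.eq_integral t ⟨ht.1, ht.2.trans hr⟩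

lemma tail (hx : IsTrajectory a b s T y u x) (hs : s ≤ r) (hr : r ≤ T) :
    IsTrajectory a b r T (x r) u x where
  intervalIntegrable := hx.intervalIntegrable.mono_set
    (by rw [uIcc_of_le hr, uIcc_of_le (hs.trans hr)]; exact Icc_subset_Icc_left hs)
  eq_integral t ht := by
    have h1 := (hx.head hs hr).intervalIntegrable
    have h2 := (hx.head (hs.trans ht.1) ht.2).intervalIntegrable
    rw [hx.eq_integral t ⟨hs.trans ht.1, ht.2⟩, hx.eq_integral r ⟨hs, hr⟩, add_assoc,
      intervalIntegral.integral_add_adjacent_intervals h1 (h1.symm.trans h2)]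

/-- The glued velocity agrees with the first one on `(s, r]` and with the second on `(r, T]`, so the
two integral equations add up. -/
lemma concat {u' : ℝ → Fin m → ℝ} {x' : ℝ → Fin n → ℝ} (hx : IsTrajectory a b s r y u x)
    (hx' : IsTrajectory a b r T (x r) u' x') (hs : s ≤ r) (hr : r ≤ T) :
    IsTrajectory a b s T y (fun τ => if τ ≤ r then u τ else u' τ)
      (fun τ => if τ ≤ r then x τ else x' τ) := by
  let f : ℝ → Fin n → ℝ := fun τ => affineField a b (if τ ≤ r then x τ else x' τ)
    (if τ ≤ r then u τ else u' τ)
  have e1 : ∀ t, t ≤ r → s ≤ t →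
      EqOn (fun τ => affineField a b (x τ) (u τ)) f (uIoc s t) := by
    intro t ht hst τ hτ
    rw [uIoc_of_le hst] at hτ
    simp [f, hτ.2.trans ht]
  have e2 : ∀ t, r ≤ t →
      EqOn (fun τ => affineField a b (x' τ) (u' τ)) f (uIoc r t) := by
    intro t hrt τ hτ
    rw [uIoc_of_le hrt] at hτ
    simp [f, not_le.2 hτ.1]
  have i1 : IntervalIntegrable f volume s r := hx.intervalIntegrable.congr (e1 r le_rfl hs)
  refine ⟨i1.trans (hx'.intervalIntegrable.congr (e2 T hr)), fun t ht => ?_⟩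
  by_cases htr : t ≤ r
  · simp only [if_pos htr]
    rw [hx.eq_integral t ⟨ht.1, htr⟩]
    congr 1
    exact intervalIntegral.integral_congr_ae (ae_of_all _ (e1 t htr ht.1))
  · have hrt : r ≤ t := (not_le.1 htr).le
    simp only [if_neg htr]
    rw [hx'.eq_integral t ⟨hrt, ht.2⟩, hx.eq_integral r ⟨hs, le_rfl⟩, add_assoc,
      intervalIntegral.integral_congr_ae (ae_of_all _ (e1 r le_rfl hs)),
      intervalIntegral.integral_congr_ae (ae_of_all _ (e2 t hrt)),
      intervalIntegral.integral_add_adjacent_intervals i1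
        ((hx'.head hrt ht.2).intervalIntegrable.congr (e2 t hrt))]

lemma norm_sub_le (hx : IsTrajectory a b s T y u x) (h : s ≤ T) :
    ‖x T - y‖ ≤ ∫ τ in s..T, ‖affineField a b (x τ) (u τ)‖ := by
  rw [hx.eq_integral T (right_mem_Icc.2 h), add_sub_cancel_left]
  exact intervalIntegral.norm_integral_le_integral_norm h

end IsTrajectory

lemma totalCost_eq_add (hs : s ≤ r) (hr : r ≤ T) :
    totalCost Q R ψ s T u x =
      ((∫⁻ t in Ioc s r, ENNReal.ofReal (runningCost Q R (x t) (u t)) : ℝ≥0∞) : EReal)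
        + totalCost Q R ψ r T u x := by
  rw [totalCost, ← Ioc_union_Ioc_eq_Ioc hs hr,
    lintegral_union measurableSet_Ioc (Ioc_disjoint_Ioc_of_le le_rfl), EReal.coe_ennreal_add,
    add_assoc, totalCost]

lemma valueFunction_le_totalCost (hu : IsAdmissibleControl U u)
    (hx : IsTrajectory a b s T y u x) :
    valueFunction a b Q R U ψ T s y ≤ totalCost Q R ψ s T u x :=
  sInf_le ⟨u, x, hu, hx, rfl⟩

/-- Dynamic programming: running along a trajectory and then optimally is never better than
running optimally. -/
lemma valueFunction_le_lintegral_add (hs : s ≤ r) (hr : r ≤ T) (hu : IsAdmissibleControl U u)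
    (hx : IsTrajectory a b s r y u x) {c : EReal}
    (hc : valueFunction a b Q R U ψ T r (x r) < c) :
    valueFunction a b Q R U ψ T s y ≤
      ((∫⁻ t in Ioc s r, ENNReal.ofReal (runningCost Q R (x t) (u t)) : ℝ≥0∞) : EReal) + c := by
  obtain ⟨_, ⟨u', x', hu', hx', rfl⟩, hlt⟩ := sInf_lt_iff.1 hc
  have hadm : IsAdmissibleControl U fun τ => if τ ≤ r then u τ else u' τ := by
    refine ⟨Measurable.ite measurableSet_Iic hu.1 hu'.1, ?_⟩
    filter_upwards [hu.2, hu'.2] with τ h1 h2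
    split_ifs <;> assumption
  refine (valueFunction_le_totalCost hadm (hx.concat hx' hs hr)).trans ?_
  rw [totalCost_eq_add hs hr]
  refine add_le_add (le_of_eq ?_) (le_of_eq_of_le ?_ hlt.le)
  · congr 1
    refine setLIntegral_congr_fun measurableSet_Ioc fun τ hτ => ?_
    simp [hτ.2]
  -- When `r = T` the glued path ends on its first branch, but then `x' T` is the starting value `x
  -- T`.
  · have hT : (if T ≤ r then x T else x' T) = x' T := by
      split_ifs with h
      · obtain rfl := le_antisymm hr h
        exact (hx'.apply_left le_rfl).symm
      · rfl
    rw [totalCost, totalCost]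
    simp only [hT]
    congr 2
    refine setLIntegral_congr_fun measurableSet_Ioc fun τ hτ => ?_
    simp [not_le.2 hτ.1]

/-- The opposite half of dynamic programming: the tail of a trajectory is a competitor for the
problem started at `(r, x r)`. -/
lemma lintegral_add_valueFunction_le (hs : s ≤ r) (hr : r ≤ T) (hu : IsAdmissibleControl U u)
    (hx : IsTrajectory a b s T y u x) :
    ((∫⁻ t in Ioc s r, ENNReal.ofReal (runningCost Q R (x t) (u t)) : ℝ≥0∞) : EReal)
        + valueFunction a b Q R U ψ T r (x r) ≤ totalCost Q R ψ s T u x := by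
  rw [totalCost_eq_add hs hr]
  exact add_le_add le_rfl (valueFunction_le_totalCost hu (hx.tail hs hr))

lemma coe_lintegral_runningCost (hQ : Q.PosDef) (hR : R.PosDef) (hs : s ≤ r)
    (hint : IntervalIntegrable (fun τ => runningCost Q R (x τ) (u τ)) volume s r) :
    ((∫⁻ t in Ioc s r, ENNReal.ofReal (runningCost Q R (x t) (u t)) : ℝ≥0∞) : EReal)
      = ((∫ t in s..r, runningCost Q R (x t) (u t) : ℝ) : EReal) := by
  rw [intervalIntegral.integral_of_le hs, ← ofReal_integral_eq_lintegral_ofReal hint.1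
    (ae_of_all _ fun _ => runningCost_nonneg hQ hR _ _), EReal.coe_ennreal_ofReal,
    max_eq_left (integral_nonneg fun _ => runningCost_nonneg hQ hR _ _)]

/-- Dynamic programming inequality in terms of real values. -/
lemma toReal_valueFunction_le (hQ : Q.PosDef) (hR : R.PosDef) (hs : s ≤ r) (hr : r ≤ T)
    (hu : IsAdmissibleControl U u) (hx : IsTrajectory a b s r y u x)
    (hint : IntervalIntegrable (fun τ => runningCost Q R (x τ) (u τ)) volume s r)
    (h1 : valueFunction a b Q R U ψ T s y ≠ ⊥)
    (h2 : valueFunction a b Q R U ψ T r (x r) ≠ ⊤)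
    (h3 : valueFunction a b Q R U ψ T r (x r) ≠ ⊥) :
    (valueFunction a b Q R U ψ T s y).toReal ≤
      (∫ τ in s..r, runningCost Q R (x τ) (u τ))
        + (valueFunction a b Q R U ψ T r (x r)).toReal := by
  refine le_of_forall_pos_le_add fun ε hε => ?_
  have h4 := valueFunction_le_lintegral_add hs hr hu hx (Q := Q) (R := R) (ψ := ψ)
    (c := (((valueFunction a b Q R U ψ T r (x r)).toReal + ε : ℝ) : EReal)) (by
      conv_lhs => rw [← EReal.coe_toReal h2 h3]
      exact_mod_cast lt_add_of_pos_right _ hε)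
  rw [coe_lintegral_runningCost hQ hR hs hint, ← EReal.coe_add] at h4
  rw [add_assoc]
  have := EReal.toReal_le_toReal h4 h1 (EReal.coe_ne_top _)
  rwa [EReal.toReal_coe] at this

/-- As `ψ` is real valued, only the nonnegative running cost could make the total infinite. -/
lemma intervalIntegrable_runningCost_of_totalCost_ne_top (hQ : Q.PosDef) (hR : R.PosDef)
    (hs : s ≤ T) (hu : Measurable u) (hx : IsTrajectory a b s T y u x)
    (h : totalCost Q R ψ s T u x ≠ ⊤) :
    IntervalIntegrable (fun τ => runningCost Q R (x τ) (u τ)) volume s T := by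
  rw [intervalIntegrable_iff_integrableOn_Ioc_of_le hs]
  have hmeas : AEStronglyMeasurable (fun τ => runningCost Q R (x τ) (u τ))
      (volume.restrict (Ioc s T)) := by
    have h1 : AEStronglyMeasurable x (volume.restrict (Ioc s T)) :=
      ((hx.continuousOn hs).mono Ioc_subset_Icc_self).aestronglyMeasurable measurableSet_Ioc
    exact (continuous_runningCost Q R).comp_aestronglyMeasurable
      (h1.prodMk hu.aestronglyMeasurable)
  rw [IntegrableOn, ← lintegral_ofReal_ne_top_iff_integrable hmeas
    (ae_of_all _ fun _ => runningCost_nonneg hQ hR _ _)]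
  intro h1
  apply h
  rw [totalCost, h1]
  simp

/-- Along a trajectory of finite cost the cost splits off its initial part. -/
lemma integral_add_toReal_valueFunction_le (hQ : Q.PosDef) (hR : R.PosDef) (hs : s ≤ r)
    (hr : r ≤ T) (hu : IsAdmissibleControl U u) (hx : IsTrajectory a b s T y u x) {c : ℝ}
    (hc : totalCost Q R ψ s T u x ≤ c)
    (h2 : valueFunction a b Q R U ψ T r (x r) ≠ ⊤)
    (h3 : valueFunction a b Q R U ψ T r (x r) ≠ ⊥) :
    (∫ τ in s..r, runningCost Q R (x τ) (u τ))
      + (valueFunction a b Q R U ψ T r (x r)).toReal ≤ c := by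
  have hint := intervalIntegrable_runningCost_of_totalCost_ne_top hQ hR (hs.trans hr) hu.1 hx
    (ne_top_of_le_ne_top (EReal.coe_ne_top c) hc)
  have hint' : IntervalIntegrable (fun τ => runningCost Q R (x τ) (u τ)) volume s r :=
    hint.mono_set (by
      rw [uIcc_of_le hs, uIcc_of_le (hs.trans hr)]; exact Icc_subset_Icc_right hr)
  have h4 := (lintegral_add_valueFunction_le hs hr hu hx).trans hc
  rw [coe_lintegral_runningCost hQ hR hs hint', ← EReal.coe_toReal h2 h3] at h4
  exact_mod_cast h4

end

/-! ### The two inequalities -/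

/-- A continuous function that is below the barrier `c` as soon as it has not crossed it before
stays below the barrier. -/
lemma lt_of_forall_le_imp_lt {g : ℝ → ℝ} {α β c : ℝ} (hg : ContinuousOn g (Icc α β))
    (hα : g α < c) (hstep : ∀ s ∈ Icc α β, (∀ τ ∈ Icc α s, g τ ≤ c) → g s < c) :
    ∀ s ∈ Icc α β, g s < c := by
  intro s hs
  by_contra! hcs
  have ivt : ∀ σ ∈ Icc α β, c ≤ g σ → ∃ τ ∈ Icc α σ, g τ = c := fun σ hσ h =>
    intermediate_value_Icc hσ.1 (hg.mono (Icc_subset_Icc_right hσ.2)) ⟨hα.le, h⟩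
  obtain ⟨τ₀, hτ₀, hτ₀c⟩ := ivt s hs hcs
  have hcomp : IsCompact (Icc α β ∩ g ⁻¹' {c}) :=
    isCompact_Icc.of_isClosed_subset (hg.preimage_isClosed_of_isClosed isClosed_Icc
      isClosed_singleton) inter_subset_left
  -- At the first time `τ₁` with `g τ₁ = c`, the barrier has not been exceeded before (the
  -- intermediate value theorem would give an earlier hit), so `hstep` applies and contradicts
  -- equality.
  obtain ⟨τ₁, ⟨hτ₁, hτ₁c⟩, hleast⟩ := hcomp.exists_isLeast ⟨τ₀, ⟨hτ₀.1, hτ₀.2.trans hs.2⟩, hτ₀c⟩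
  refine (hstep τ₁ hτ₁ fun τ hτ => ?_).ne hτ₁c
  by_contra! hlt
  obtain ⟨σ, hσ, hσc⟩ := ivt τ ⟨hτ.1, hτ.2.trans hτ₁.2⟩ hlt.le
  have h1 := hleast ⟨⟨hσ.1, hσ.2.trans (hτ.2.trans hτ₁.2)⟩, hσc⟩
  have h2 : σ = τ := le_antisymm hσ.2 (hτ.2.trans h1)
  exact hlt.ne' (h2 ▸ hσc)

section

variable {n m : ℕ} {a : (Fin n → ℝ) → Matrix (Fin n) (Fin n) ℝ}
  {b : (Fin n → ℝ) → Matrix (Fin n) (Fin m) ℝ}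
  {Q : Matrix (Fin n) (Fin n) ℝ} {R : Matrix (Fin m) (Fin m) ℝ} {U : Set (Fin m → ℝ)}
  {ψ : (Fin n → ℝ) → ℝ} {T t : ℝ} {x : Fin n → ℝ} {D : ℝ × (Fin n → ℝ) →L[ℝ] ℝ}

/-- The elementary inequality `V_t + L + V_x f ≥ 0`. -/
lemma hamiltonian_integrand_nonneg (ha : Continuous a) (hb : Continuous b)
    (hQ : Q.PosDef) (hR : R.PosDef) (hT : 0 < T) (ht : t ∈ Icc (0 : ℝ) T)
    (hD : HasDifferentialOnStrip T (valueFunction a b Q R U ψ T) D (t, x))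
    {u : Fin m → ℝ} (hu : u ∈ U) :
    0 ≤ D (1, affineField a b x u) + runningCost Q R x u := by
  have hF := continuous_affineField ha hb u
  obtain ⟨h, hh, X, hX, hXt, hXeq⟩ := exists_local_integral_solution hF x t
  have hFX : Continuous fun τ => affineField a b (X τ) u := hF.comp hX
  have hLX : Continuous fun τ => runningCost Q R (X τ) u :=
    (continuous_runningCost Q R).comp (hX.prodMk continuous_const)
  have hadm : IsAdmissibleControl U fun _ : ℝ => u := ⟨measurable_const, ae_of_all _ fun _ => hu⟩
  have htraj : ∀ s r, |s - t| ≤ h → |r - t| ≤ h →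
      IsTrajectory a b s r (X s) (fun _ => u) X := by
    intro s r hs hr
    refine ⟨hFX.intervalIntegrable _ _, fun τ hτ => ?_⟩
    have hτh : |τ - t| ≤ h := by
      rw [abs_le] at *
      constructor <;> linarith [hτ.1, hτ.2]
    rw [hXeq τ hτh, hXeq s hs, add_assoc, intervalIntegral.integral_add_adjacent_intervals
      (hFX.intervalIntegrable _ _) (hFX.intervalIntegrable _ _)]
  have hnear : ∀ᶠ s in 𝓝 t, |s - t| ≤ h := by
    filter_upwards [Metric.closedBall_mem_nhds t hh] with s hs using hs
  have hXd : HasDerivAt X (affineField a b x u) t := by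
    have h1 : HasDerivAt (fun s => x + ∫ τ in t..s, affineField a b (X τ) u)
        (affineField a b (X t) u) t :=
      (intervalIntegral.integral_hasDerivAt_right (hFX.intervalIntegrable _ _)
        (hFX.stronglyMeasurableAtFilter _ _) hFX.continuousAt).const_add x
    rw [hXt] at h1
    exact h1.congr_of_eventuallyEq (hnear.mono fun s hs => hXeq s hs)
  have hγ : HasDerivWithinAt (fun s => (s, X s)) (1, affineField a b x u) (Icc 0 T) t :=
    ((hasDerivAt_id t).prodMk hXd).hasDerivWithinAt
  have hmaps : MapsTo (fun s => (s, X s)) (Icc 0 T) (Icc 0 T ×ˢ univ) := fun s hs => ⟨hs, trivial⟩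
  have hfin : ∀ᶠ s in 𝓝[Icc 0 T] t, valueFunction a b Q R U ψ T s (X s) ≠ ⊤ ∧
      valueFunction a b Q R U ψ T s (X s) ≠ ⊥ := by
    have h1 : Tendsto (fun s => (s, X s)) (𝓝[Icc 0 T] t) (𝓝[Icc 0 T ×ˢ univ] (t, x)) := by
      have := hγ.continuousWithinAt.tendsto_nhdsWithin hmaps
      rwa [hXt] at this
    exact h1.eventually hD.1
  have hV : HasDerivWithinAt (fun s => (valueFunction a b Q R U ψ T s (X s)).toReal)
      (D (1, affineField a b x u)) (Icc 0 T) t := by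
    have h1 := hD.2
    rw [← hXt] at h1
    exact (h1.comp_hasDerivWithinAt t hγ hmaps :)
  have hL : HasDerivWithinAt (fun s => ∫ τ in t..s, runningCost Q R (X τ) u)
      (runningCost Q R x u) (Icc 0 T) t := by
    have h1 := intervalIntegral.integral_hasDerivAt_right (hLX.intervalIntegrable t t)
      (hLX.stronglyMeasurableAtFilter _ _) hLX.continuousAt
    rw [hXt] at h1
    exact h1.hasDerivWithinAt
  have hslope := hasDerivWithinAt_iff_tendsto_slope.1 (hV.add hL)
  -- Since `T > 0`, the time `t` is an accumulation point of `[0, T]` even when it is an endpoint,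
  -- so the sign of the difference quotients passes to the limit.
  have hne : (𝓝[Icc 0 T \ {t}] t).NeBot :=
    accPt_principal_iff_nhdsWithin.1 (uniqueDiffOn_Icc hT t ht).accPt
  have hVt := hfin.self_of_nhdsWithin ht
  refine ge_of_tendsto hslope ?_
  filter_upwards [nhdsWithin_mono t sdiff_subset hfin, mem_nhdsWithin_of_mem_nhds hnear,
    self_mem_nhdsWithin] with s hs hsh hsT
  rw [slope_def_field]
  simp only [Pi.add_apply, intervalIntegral.integral_same, add_zero]
  have htt : |t - t| ≤ h := by simpa using hh.le
  -- For `s < t` the trajectory runs from `(s, X s)` into `(t, x)`: numerator and denominator of the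
  -- slope are both nonpositive.
  rcases lt_or_gt_of_ne (show s ≠ t from hsT.2) with hst | hst
  · have h1 := toReal_valueFunction_le (ψ := ψ) hQ hR hst.le ht.2 hadm (htraj s t hsh htt)
      (hLX.intervalIntegrable _ _) hs.2 hVt.1 hVt.2
    rw [intervalIntegral.integral_symm] at h1
    exact div_nonneg_of_nonpos (by linarith) (by linarith)
  · have h1 := toReal_valueFunction_le (ψ := ψ) hQ hR hst.le hsT.1.2 hadm (htraj t s htt hsh)
      (hLX.intervalIntegrable _ _) hVt.2 hs.1 hs.2
    exact div_nonneg (by linarith) (by linarith)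

/-- The coercivity of the cost bounds the cost and the displacement of a trajectory over a short
time, if its cost is controlled by its displacement. -/
lemma cost_le_and_displacement_le {M K h s r : ℝ} (hM : 1 ≤ M) (hK : 0 ≤ K)
    (hf : ∀ y, ‖y - x‖ ≤ 1 → ∀ u, M * ‖affineField a b y u‖ ≤ runningCost Q R y u / 2 + K)
    {u : ℝ → Fin m → ℝ} {X : ℝ → Fin n → ℝ} (hX : IsTrajectory a b s r x u X) (hs : s ≤ r)
    (hh : r - s ≤ h) (hball : ∀ τ ∈ Icc s r, ‖X τ - x‖ ≤ 1)
    (hint : IntervalIntegrable (fun τ => runningCost Q R (X τ) (u τ)) volume s r)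
    (hcost : ∫ τ in s..r, runningCost Q R (X τ) (u τ) ≤ M * (2 * h + ‖X r - x‖) + h) :
    ∫ τ in s..r, runningCost Q R (X τ) (u τ) ≤ 2 * (2 * M + K + 1) * h ∧
      ‖X r - x‖ ≤ (2 * M + 2 * K + 1) * h := by
  have h1 : M * ‖X r - x‖ ≤ (∫ τ in s..r, runningCost Q R (X τ) (u τ)) / 2 + K * h := by
    calc M * ‖X r - x‖ ≤ M * ∫ τ in s..r, ‖affineField a b (X τ) (u τ)‖ :=
          mul_le_mul_of_nonneg_left (hX.norm_sub_le hs) (by linarith)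
      _ = ∫ τ in s..r, M * ‖affineField a b (X τ) (u τ)‖ :=
          (intervalIntegral.integral_const_mul _ _).symm
      _ ≤ ∫ τ in s..r, (runningCost Q R (X τ) (u τ) / 2 + K) :=
          intervalIntegral.integral_mono_on hs (hX.intervalIntegrable.norm.const_mul M)
            ((hint.div_const 2).add intervalIntegrable_const) fun τ hτ => hf _ (hball τ hτ) _
      _ = (∫ τ in s..r, runningCost Q R (X τ) (u τ)) / 2 + K * (r - s) := by
          rw [intervalIntegral.integral_add (hint.div_const 2) intervalIntegrable_const,
            intervalIntegral.integral_div, intervalIntegral.integral_const, smul_eq_mul,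
            mul_comm (r - s)]
      _ ≤ _ := by gcongr
  have h2 : ‖X r - x‖ ≤ M * ‖X r - x‖ := le_mul_of_one_le_left (norm_nonneg _) hM
  constructor <;> linarith

/-- The interval extends forwards or backwards from `t`, whichever side has room, so endpoint times
need no separate treatment. -/
lemma exists_subinterval (ht : t ∈ Icc (0 : ℝ) T) {h : ℝ} (hh : 0 < h) (hhT : h ≤ T / 2) :
    ∃ s r, 0 ≤ s ∧ s ≤ t ∧ t ≤ r ∧ r ≤ T ∧ r = s + h := by
  obtain ⟨h0, hT⟩ := ht
  rcases le_total t (T / 2) with h1 | h1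
  · exact ⟨t, t + h, h0, le_rfl, by linarith, by linarith, rfl⟩
  · exact ⟨t - h, t, by linarith, by linarith, le_rfl, hT, by ring⟩

set_option maxHeartbeats 1000000 in
/-- The optimality inequality: `V_t + L + V_x f` has no positive lower bound over the controls. -/
lemma exists_hamiltonian_integrand_lt (ha : Continuous a) (hb : Continuous b)
    (hQ : Q.PosDef) (hR : R.PosDef) (hT : 0 < T) (ht : t ∈ Icc (0 : ℝ) T)
    (hD : HasDifferentialOnStrip T (valueFunction a b Q R U ψ T) D (t, x))
    {δ : ℝ} (hδ : 0 < δ) :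
    ∃ u ∈ U, D (1, affineField a b x u) + runningCost Q R x u < δ := by
  by_contra! hcon
  set V := valueFunction a b Q R U ψ T with hVdef
  set p : (Fin n → ℝ) →L[ℝ] ℝ := D.comp (ContinuousLinearMap.inr ℝ ℝ (Fin n → ℝ)) with hp
  set q : ℝ := D (1, 0) with hq
  have hDqp : ∀ (σ : ℝ) (v : Fin n → ℝ), D (σ, v) = q * σ + p v := by
    intro σ v
    have : (σ, v) = σ • ((1 : ℝ), (0 : Fin n → ℝ)) + (0, v) := by simp
    rw [this, map_add, map_smul, smul_eq_mul, mul_comm]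
    rfl
  -- As `ε ≤ 1`, `M` bounds the increments of `V` from `(t, x)`; the velocity bound is then taken
  -- with this same `M`.
  set M : ℝ := ‖D‖ + 1 with hMdef
  have hM : 1 ≤ M := by simp [hMdef]
  obtain ⟨K, hK, hf⟩ := exists_norm_affineField_le ha hb hQ hR x (zero_le_one.trans hM)
  set A : ℝ := 2 * (2 * M + K + 1) with hA
  set B : ℝ := 2 * M + 2 * K + 1 with hB
  have hA0 : 0 ≤ A := by positivity
  have hB0 : 0 ≤ B := by positivity
  -- The errors to come total `ε (3 + A + B) h`: `ε h` from `V` at the start, `ε (1 + B) h` from `V`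
  -- at the end, and `ε (1 + A) h` from moving the integrand from the trajectory to `x`.
  set ε : ℝ := min 1 (δ / (4 * (3 + A + B))) with hε
  have hε0 : 0 < ε := by positivity
  have hε1 : ε ≤ 1 := min_le_left _ _
  have hεδ : ε * (3 + A + B) ≤ δ / 4 := by
    have : ε ≤ δ / (4 * (3 + A + B)) := min_le_right _ _
    rw [le_div_iff₀ (by positivity)] at this
    linarith
  obtain ⟨ρ, hρ, hham⟩ := exists_hamiltonian_integrand_le ha hb hQ hR x p hε0
  obtain ⟨r₀, hr₀, hloc⟩ := (nhdsWithin_hasBasis Metric.nhds_basis_closedBall _).eventually_iff.1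
    (hD.1.and (hD.2.isLittleO.def hε0))
  have hloc' : ∀ s ∈ Icc (0 : ℝ) T, ∀ y : Fin n → ℝ, |s - t| ≤ r₀ → ‖y - x‖ ≤ r₀ →
      (V s y ≠ ⊤ ∧ V s y ≠ ⊥) ∧
      |(V s y).toReal - (V t x).toReal - (q * (s - t) + p (y - x))|
        ≤ ε * (|s - t| + ‖y - x‖) ∧
      |(V s y).toReal - (V t x).toReal| ≤ M * (|s - t| + ‖y - x‖) := by
    intro s hs y hst hyx
    have hmem : (s, y) ∈ Metric.closedBall (t, x) r₀ := by
      rw [mem_closedBall_iff_norm]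
      exact max_le hst hyx
    have hnorm : ‖(s, y) - (t, x)‖ ≤ |s - t| + ‖y - x‖ :=
      max_le (le_add_of_nonneg_right (norm_nonneg _)) (le_add_of_nonneg_left (abs_nonneg _))
    obtain ⟨h1, h2⟩ := hloc ⟨hmem, hs, trivial⟩
    have h3 : D ((s, y) - (t, x)) = q * (s - t) + p (y - x) := hDqp _ _
    have h4 := D.le_opNorm ((s, y) - (t, x))
    rw [Real.norm_eq_abs] at h2 h4
    rw [h3] at h2 h4
    refine ⟨h1, h2.trans (mul_le_mul_of_nonneg_left hnorm hε0.le), ?_⟩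
    have h5 : ‖D‖ * ‖(s, y) - (t, x)‖ + ε * ‖(s, y) - (t, x)‖
        ≤ M * (|s - t| + ‖y - x‖) := by
      rw [← add_mul]
      exact mul_le_mul (by linarith) hnorm (norm_nonneg _) (by linarith)
    refine le_trans ?_ h5
    rw [abs_le] at *
    constructor <;> linarith [h2.1, h2.2, h4.1, h4.2]
  set r : ℝ := min r₀ 1 with hr
  have hr0 : 0 < r := by positivity
  -- Both `h` and `B h` will be at most `κ`. The bounds serve, in order, the barrier at `r`, the
  -- continuity estimate, the fit of the interval in `[0, T]`, and `h ^ 2 ≤ δ h / 4`.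
  set κ : ℝ := min (r / 2) (min ρ (min (T / 2) (δ / 4))) with hκ
  have hκ0 : 0 < κ := by positivity
  set h : ℝ := κ / (B + 1) with hh
  have hh0 : 0 < h := by positivity
  have hBh : (B + 1) * h = κ := mul_div_cancel₀ _ (by positivity)
  have hhκ : h ≤ κ := by nlinarith
  have hBhκ : B * h ≤ κ := by linarith
  have hκr : κ ≤ r / 2 := min_le_left _ _
  have hκρ : κ ≤ ρ := (min_le_right _ _).trans (min_le_left _ _)
  have hκT : κ ≤ T / 2 := (min_le_right _ _).trans ((min_le_right _ _).trans (min_le_left _ _))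
  have hκδ : κ ≤ δ / 4 := (min_le_right _ _).trans ((min_le_right _ _).trans (min_le_right _ _))
  have hrr₀ : r ≤ r₀ := min_le_left _ _
  have hr1 : r ≤ 1 := min_le_right _ _
  obtain ⟨s₀, s₁, h0s, hst, hts, hsT, rfl⟩ := exists_subinterval ht hh0 (hhκ.trans hκT)
  have hs01 : s₀ ≤ s₀ + h := by linarith
  have habs : ∀ s ∈ Icc s₀ (s₀ + h), |s - t| ≤ h := fun s hs =>
    abs_le.2 ⟨by linarith [hs.1], by linarith [hs.2]⟩
  have hstrip : ∀ s ∈ Icc s₀ (s₀ + h), s ∈ Icc 0 T := fun s hs =>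
    ⟨h0s.trans hs.1, hs.2.trans hsT⟩
  have hnear : ∀ s ∈ Icc s₀ (s₀ + h), |s - t| ≤ r₀ := fun s hs =>
    (habs s hs).trans (by linarith)
  have hs₀ : s₀ ∈ Icc s₀ (s₀ + h) := left_mem_Icc.2 hs01
  have hs₁ : s₀ + h ∈ Icc s₀ (s₀ + h) := right_mem_Icc.2 hs01
  obtain ⟨⟨hfin, hfin'⟩, hW₀, hW₀'⟩ := hloc' s₀ (hstrip _ hs₀) x (hnear _ hs₀) (by simpa using hr₀.le)
  simp only [sub_self, map_zero, norm_zero, add_zero] at hW₀ hW₀'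
  -- a trajectory that is optimal up to `h ^ 2`
  have hlt : V s₀ x < (((V s₀ x).toReal + h ^ 2 : ℝ) : EReal) := by
    conv_lhs => rw [← EReal.coe_toReal hfin hfin']
    exact_mod_cast lt_add_of_pos_right _ (by positivity)
  obtain ⟨_, ⟨u, X, hu, hX, rfl⟩, hc⟩ := sInf_lt_iff.1 hlt
  have hs₀T : s₀ ≤ T := hst.trans ht.2
  have hint := intervalIntegrable_runningCost_of_totalCost_ne_top hQ hR hs₀T hu.1 hX
    (ne_top_of_lt hc)
  have hintσ : ∀ s ∈ Icc s₀ (s₀ + h),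
      IntervalIntegrable (fun τ => runningCost Q R (X τ) (u τ)) volume s₀ s := fun s hs =>
    hint.mono_set (by
      rw [uIcc_of_le hs.1, uIcc_of_le hs₀T]; exact Icc_subset_Icc_right (hstrip s hs).2)
  have hdpp : ∀ s ∈ Icc s₀ (s₀ + h), ‖X s - x‖ ≤ r →
      (∫ τ in s₀..s, runningCost Q R (X τ) (u τ)) + (V s (X s)).toReal
        ≤ (V s₀ x).toReal + h ^ 2 := by
    intro s hs hXs
    obtain ⟨⟨h1, h2⟩, -⟩ := hloc' s (hstrip s hs) (X s) (hnear s hs) (hXs.trans hrr₀)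
    exact integral_add_toReal_valueFunction_le hQ hR hs.1 (hstrip s hs).2 hu hX hc.le h1 h2
  have hest : ∀ s ∈ Icc s₀ (s₀ + h), (∀ τ ∈ Icc s₀ s, ‖X τ - x‖ ≤ r) →
      ∫ τ in s₀..s, runningCost Q R (X τ) (u τ) ≤ A * h ∧ ‖X s - x‖ ≤ B * h := by
    intro s hs hball
    have hXs := hball s (right_mem_Icc.2 hs.1)
    refine cost_le_and_displacement_le hM hK hf (hX.head hs.1 (hstrip s hs).2) hs.1
      (by linarith [hs.2]) (fun τ hτ => (hball τ hτ).trans hr1) (hintσ s hs) ?_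
    obtain ⟨-, -, h1⟩ := hloc' s (hstrip s hs) (X s) (hnear s hs) (hXs.trans hrr₀)
    have h2 := hdpp s hs hXs
    have h3 : M * |s₀ - t| ≤ M * h := mul_le_mul_of_nonneg_left (habs _ hs₀) (by linarith)
    have h4 : M * |s - t| ≤ M * h := mul_le_mul_of_nonneg_left (habs _ hs) (by linarith)
    have h5 : h ^ 2 ≤ h := by nlinarith
    have h6 := (abs_le.1 h1).1
    have h7 := (abs_le.1 hW₀').2
    linarith
  -- Bootstrap: as long as the trajectory has stayed within `r`, `hest` puts it within `B h ≤ r /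
  -- 2`, so it never reaches `r`.
  have hXr : ∀ s ∈ Icc s₀ (s₀ + h), ‖X s - x‖ < r := by
    refine lt_of_forall_le_imp_lt ?_ ?_ fun s hs hball => ?_
    · exact (((hX.continuousOn hs₀T).mono (Icc_subset_Icc_right hsT)).sub continuousOn_const).norm
    · simpa [hX.apply_left hs₀T] using hr0
    · have := (hest s hs hball).2
      linarith
  have hest' : ∀ s ∈ Icc s₀ (s₀ + h),
      ∫ τ in s₀..s, runningCost Q R (X τ) (u τ) ≤ A * h ∧ ‖X s - x‖ ≤ B * h := fun s hs =>
    hest s hs fun τ hτ => (hXr τ ⟨hτ.1, hτ.2.trans hs.2⟩).le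
  set Λ : ℝ := ∫ τ in s₀..(s₀ + h), runningCost Q R (X τ) (u τ) with hΛ
  obtain ⟨hΛA, hXB⟩ := hest' _ hs₁
  have hX' := hX.head hs01 hsT
  have hintΛ := hintσ _ hs₁
  have hintp : IntervalIntegrable (fun τ => p (affineField a b (X τ) (u τ))) volume s₀ (s₀ + h) :=
    ⟨p.integrable_comp hX'.intervalIntegrable.1, p.integrable_comp hX'.intervalIntegrable.2⟩
  have hpX : ∫ τ in s₀..(s₀ + h), p (affineField a b (X τ) (u τ)) = p (X (s₀ + h) - x) := by
    rw [p.intervalIntegral_comp_comm hX'.intervalIntegrable, hX'.eq_integral _ hs₁,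
      add_sub_cancel_left]
  -- The contradiction hypothesis, transferred from `x` to `X τ` and integrated; the velocity
  -- integrates to the displacement.
  have hlower : (δ - q - ε) * h - ε * Λ ≤ Λ + p (X (s₀ + h) - x) := by
    have h1 : ∫ τ in s₀..(s₀ + h), ((δ - q - ε) - ε * runningCost Q R (X τ) (u τ))
        ≤ ∫ τ in s₀..(s₀ + h),
          (runningCost Q R (X τ) (u τ) + p (affineField a b (X τ) (u τ))) := by
      refine intervalIntegral.integral_mono_ae_restrict hs01
        (intervalIntegrable_const.sub (hintΛ.const_mul ε)) (hintΛ.add hintp) ?_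
      filter_upwards [ae_restrict_of_ae hu.2, ae_restrict_mem measurableSet_Icc] with τ hτU hτ
      have h2 := hcon _ hτU
      rw [hDqp, mul_one] at h2
      have h3 := hham (X τ) ((hest' τ hτ).2.trans (hBhκ.trans hκρ)) (u τ)
      linarith
    rw [intervalIntegral.integral_sub intervalIntegrable_const (hintΛ.const_mul ε),
      intervalIntegral.integral_const, intervalIntegral.integral_const_mul,
      intervalIntegral.integral_add hintΛ hintp, hpX, smul_eq_mul, add_sub_cancel_left] at h1
    linarith
  obtain ⟨-, hW₁, -⟩ := hloc' _ (hstrip _ hs₁) _ (hnear _ hs₁) ((hXr _ hs₁).le.trans hrr₀)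
  have hd := hdpp _ hs₁ (hXr _ hs₁).le
  have e1 : ε * (|s₀ + h - t| + ‖X (s₀ + h) - x‖) ≤ ε * (h + B * h) :=
    mul_le_mul_of_nonneg_left (add_le_add (habs _ hs₁) hXB) hε0.le
  have e2 : ε * |s₀ - t| ≤ ε * h := mul_le_mul_of_nonneg_left (habs _ hs₀) hε0.le
  have e3 : ε * Λ ≤ ε * (A * h) := mul_le_mul_of_nonneg_left hΛA hε0.le
  have h6 := (abs_le.1 hW₁).1
  have h7 := (abs_le.1 hW₀).2
  -- Both terms on the right are at most `δ h / 4`, which is impossible as `δ h > 0`.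
  have h8 : δ * h ≤ h ^ 2 + ε * (3 + A + B) * h := by linarith
  nlinarith [mul_le_mul_of_nonneg_right hεδ hh0.le, mul_pos hδ hh0]

end

theorem mainTheorem4 {n m : ℕ} (a : (Fin n → ℝ) → Matrix (Fin n) (Fin n) ℝ)
    (b : (Fin n → ℝ) → Matrix (Fin n) (Fin m) ℝ) (ha : Continuous a) (hb : Continuous b)
    (Q : Matrix (Fin n) (Fin n) ℝ) (R : Matrix (Fin m) (Fin m) ℝ)
    (hQ : Q.PosDef) (hR : R.PosDef) (U : Set (Fin m → ℝ)) (ψ : (Fin n → ℝ) → ℝ)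
    (T : ℝ) (hT : 0 < T) (t : ℝ) (ht : t ∈ Icc (0 : ℝ) T) (x : Fin n → ℝ)
    (D : ℝ × (Fin n → ℝ) →L[ℝ] ℝ)
    (hD : HasDifferentialOnStrip T (valueFunction a b Q R U ψ T) D (t, x)) :
    ((D (1, 0) : ℝ) : EReal)
      + hamiltonian a b Q R U x (D.comp (ContinuousLinearMap.inr ℝ ℝ (Fin n → ℝ))) = 0 := by
  have hsplit : ∀ u, D (1, affineField a b x u) = D (1, 0) +
      D.comp (ContinuousLinearMap.inr ℝ ℝ (Fin n → ℝ)) (affineField a b x u) := by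
    intro u
    rw [ContinuousLinearMap.comp_apply, ContinuousLinearMap.inr_apply, ← map_add]
    simp
  have hH : hamiltonian a b Q R U x (D.comp (ContinuousLinearMap.inr ℝ ℝ (Fin n → ℝ)))
      = ((-D (1, 0) : ℝ) : EReal) := by
    refine le_antisymm (le_of_forall_gt fun c hc => ?_) (le_iInf₂ fun u hu => ?_)
    -- A real `d` strictly between `-V_t` and `c` provides the gap `δ = d + V_t`. The control
    -- obtained also shows that the infimum is not over an empty set.
    · obtain ⟨d, hd, hdc⟩ := EReal.lt_iff_exists_real_btwn.1 hc
      have hd' : -D (1, 0) < d := by exact_mod_cast hd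
      obtain ⟨u, hu, hlt⟩ := exists_hamiltonian_integrand_lt ha hb hQ hR hT ht hD
        (δ := d + D (1, 0)) (by linarith)
      refine (iInf₂_le u hu).trans_lt (lt_trans ?_ hdc)
      rw [hsplit] at hlt
      exact_mod_cast (by linarith)
    · have := hamiltonian_integrand_nonneg ha hb hQ hR hT ht hD hu
      rw [hsplit] at this
      exact_mod_cast (by linarith)
  rw [hH, ← EReal.coe_add, add_neg_cancel, EReal.coe_zero]
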